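/- Let $\Gamma\subset\mathbb S^3$ be the skeleton (1-skeleton) of a triangular prism, that is, the image, under some homeomorphism of $\mathbb S^3$ onto itself, of the 1-skeleton of a convex triangular prism in an open hemisphere of $\mathbb S^3$ (identified with Euclidean 3-space by central projection). A meridional curve of an edge $e$ of $\Gamma$ is the boundary of a disc that meets $\Gamma$ transversely in a single point, which is an interior point of $e$: a curve $h(\{|z|=1\}\times\{0\})$, where $h\colon\mathbb C\times\mathbb R\to\mathbb S^3$ is an open embedding with $h^{-1}(\Gamma)=\{0\}\times\mathbb R$ and with $h(\{0\}\times\mathbb R)$ contained in the interior of $e$. Then there exists a seven-fold covering $p\colon E\to\mathbb S^3\setminus\Gamma$ such that the link of every edge of $\Gamma$ is covered non-trivially, that is, for every edge $e$ of $\Gamma$ and every meridional curve $c$ of $e$ the preimage $p^{-1}(c)$ is connected. Moreover, $p$ can be chosen to be cyclic and to come from a homomorphism to $\mathbb Z/7$: the group $\mathbb Z/7$ acts on $E$ by homeomorphisms over $\mathbb S^3\setminus\Gamma$, freely and transitively on every fibre, and for every base point $x_0$ there is a homomorphism $\varphi\colon\pi_1(\mathbb S^3\setminus\Gamma,x_0)\to\mathbb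 Z/7$ such that the lift of a loop $\gamma$ at $x_0$ that starts at $\tilde x\in p^{-1}(x_0)$ ends at $\varphi([\gamma])\cdot\tilde x$, and $\varphi$ maps every meridional element (the class of a path from $x_0$ to a meridional curve, followed by that curve once around and the reversed path) to a nonzero element. -/

import Mathlib

open scoped unitInterval

noncomputable section

/-- The 3-sphere, as the unit sphere of `ℝ⁴`. -/
abbrev S3 : Type := Metric.sphere (0 : EuclideanSpace ℝ (Fin 4)) 1

/-- The graph of a triangular prism: two vertices `(i, j)` and `(i', j')` are adjacent iff they
agree in exactly one coordinate. The triangles are `j = 0` and `j = 1`. -/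
def prismGraph : SimpleGraph (Fin 3 × Fin 2) :=
  SimpleGraph.boxProd (⊤ : SimpleGraph (Fin 3)) (⊤ : SimpleGraph (Fin 2))

/-- The vertices of a right triangular prism in the affine hyperplane `x₀ + x₁ + x₂ = 1`
of `ℝ⁴` (a copy of Euclidean 3-space that misses the origin): the product of the standard
triangle with `[0, 1]`. -/
def prismVertex (a : Fin 3 × Fin 2) : EuclideanSpace ℝ (Fin 4) :=
  EuclideanSpace.single a.1.castSucc (1 : ℝ) + EuclideanSpace.single 3 ((a.2 : ℕ) : ℝ)

/-- The radial projection from the origin of a subset of `ℝ⁴` to the 3-sphere. On the hyperplane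
`x₀ + x₁ + x₂ = 1` it is an embedding onto an open hemisphere. -/
def radialProjection (A : Set (EuclideanSpace ℝ (Fin 4))) : Set S3 :=
  {x | ∃ r : ℝ, 0 < r ∧ r • (x : EuclideanSpace ℝ (Fin 4)) ∈ A}

/-- The 1-skeleton of the standard triangular prism in the 3-sphere: the union of its nine
closed edges. -/
def stdPrismSkeleton : Set S3 :=
  {x | ∃ a b, prismGraph.Adj a b ∧ x ∈ radialProjection (segment ℝ (prismVertex a) (prismVertex b))}

/-- The open edge (without its two end points) of the standard prism that joins the vertices
`a` and `b`. -/
def stdPrismEdge (a b : Fin 3 × Fin 2) : Set S3 :=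
  radialProjection (openSegment ℝ (prismVertex a) (prismVertex b))

/-- `h` is a coordinate cylinder around a piece of the open edge `e` of the graph `Γ`: it embeds
`ℂ × ℝ` as an open subset of the sphere that meets `Γ` exactly along the axis `{0} × ℝ`, and the
axis goes to `e`. Thus the disc `z ↦ h (z, 0)`, `‖z‖ ≤ 1`, is transverse to `Γ` and meets it in a
single point, which lies on `e`; its boundary is a meridional curve of `e`. -/
structure IsMeridianChart (Γ e : Set S3) (h : ℂ × ℝ → S3) : Prop where
  isOpenEmbedding : Topology.IsOpenEmbedding h
  mem_iff : ∀ z t, h (z, t) ∈ Γ ↔ z = 0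
  axis_mem : ∀ t, h (0, t) ∈ e

/-- The meridional curve of a coordinate cylinder, in the complement of the graph. -/
def meridianCurve (Γ : Set S3) (h : ℂ × ℝ → S3) : Set ↥Γᶜ :=
  {x | ∃ z : ℂ, ‖z‖ = 1 ∧ h (z, 0) = x}

/-- The loop `m` runs once around the meridional curve of the coordinate cylinder `h`. -/
def IsMeridianLoop {Γ : Set S3} (h : ℂ × ℝ → S3) {x : ↥Γᶜ} (m : Path x x) : Prop :=
  ∀ t : I, ((m t : ↥Γᶜ) : S3) = h (Complex.exp (2 * Real.pi * (t : ℝ) * Complex.I), 0)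

end

/-! To each lateral face `i` belongs a function `g i = prismFace i` on `ℝ⁴`, homogeneous of degree
1, whose nontrivial zeros form the cone over the boundary of the face and which winds once, with a
sign, around each side. Put `f = g 0 * g 1 ^ 2 * g 2 ^ 4`; its zeros on the sphere are the skeleton
(`prismFun_eq_zero_iff`). A top or bottom edge lies on one lateral face, so `f` winds 1, 2 or 4
times around it, up to sign. A vertical edge lies on two, which wind in opposite senses, so the
number is a difference of two of 1, 2, 4. None of these is divisible by 7.

The covering is the space of seventh roots of `f`, on which `ℤ/7` acts through roots of unity. A
loop whose monodromy fixes a point carries a closed seventh root of `f`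
(`RootSpace.hasClosedRoot_of_monodromy_eq`).

For a meridian of an arbitrary topological chart no winding number is computed. A small round loop
inside the chart has no closed root, by the local form of `f` (`exists_loop_not_hasClosedRoot`). But
a closed root along the meridian, which generates the fundamental group of `(ℂ ∖ 0) × ℝ`, would give
one along every loop of the chart off the axis (`HasClosedRoot.of_unit_circle`). So the monodromy is
nontrivial, and, 7 being prime, it generates the deck group. -/

noncomputable section

/-! ### Roots of complex functions along loops -/

/-- A continuous function on a preconnected space whose `n`-th power is a nonzero constant is
constant. -/
theorem eq_of_pow_eq_const {X : Type*} [TopologicalSpace X] [PreconnectedSpace X] {n : ℕ}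
    (hn : n ≠ 0) {q : X → ℂ} (hq : Continuous q) {c : ℂ} (hc : c ≠ 0) (h : ∀ x, q x ^ n = c)
    (x y : X) : q x = q y := by
  have hn' : (n : ℂ) ≠ 0 := by exact_mod_cast hn
  have hq0 : ∀ x, q x ≠ 0 := fun x h0 ↦ hc (by rw [← h x, h0, zero_pow hn])
  have := (isCoveringMap_npow n hn').const_of_comp (g := fun x ↦ (⟨q x, hq0 x⟩ : {z : ℂ // z ≠ 0}))
    (by fun_prop) (fun a a' ↦ Subtype.ext (by simp [h])) x y
  exact congrArg Subtype.val this

/-- A continuous `n`-th root of `f` along a loop that closes up. -/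
def HasClosedRoot (n : ℕ) (f : I → ℂ) : Prop :=
  ∃ R : I → ℂ, Continuous R ∧ R 0 = R 1 ∧ ∀ t, R t ^ n = f t

open Complex in
/-- A nowhere zero function on a simply connected space has a continuous logarithm. -/
theorem exists_continuous_log {X : Type*} [TopologicalSpace X] [SimplyConnectedSpace X]
    [LocallyPathConnectedSpace X] {f : X → ℂ} (hf : Continuous f) (h0 : ∀ x, f x ≠ 0) :
    ∃ g : X → ℂ, Continuous g ∧ ∀ x, exp (g x) = f x := by
  obtain ⟨x₀⟩ : Nonempty X := inferInstance
  obtain ⟨g, ⟨-, hg⟩, -⟩ := isCoveringMapOn_exp.existsUnique_continuousMap_lifts ⟨f, hf⟩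
    (a₀ := x₀) (e₀ := log (f x₀)) (exp_log (h0 x₀)) h0
  exact ⟨g, g.continuous, congrFun hg⟩

open Complex in
/-- If a function on `(ℂ ∖ 0) × ℝ` has a closed `n`-th root along the unit circle, then it has an
`n`-th root. -/
theorem exists_periodic_root {n : ℕ} (hn : n ≠ 0) {A : ℂ × ℝ → ℂ} (hA : Continuous A)
    (h0 : ∀ z t, z ≠ 0 → A (z, t) ≠ 0)
    (h : HasClosedRoot n fun t ↦ A (exp (2 * Real.pi * (t : ℝ) * Complex.I), 0)) :
    ∃ S : ℂ × ℝ → ℂ, Continuous S ∧ (∀ w t, S (w, t) ^ n = A (exp w, t)) ∧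
      ∀ w t, S (w + 2 * Real.pi * Complex.I, t) = S (w, t) := by
  obtain ⟨g, hg, hgA⟩ := exists_continuous_log (X := ℂ × ℝ) (f := fun q ↦ A (exp q.1, q.2))
    (by fun_prop) (fun q ↦ h0 _ _ (exp_ne_zero _))
  have hn' : (n : ℂ) ≠ 0 := by exact_mod_cast hn
  have hroot : ∀ w t, exp (g (w, t) / n) ^ n = A (exp w, t) := by
    intro w t
    rw [← exp_nat_mul, mul_div_cancel₀ _ hn', hgA]
  refine ⟨fun q ↦ exp (g q / n), by fun_prop, hroot, fun w t ↦ ?_⟩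
  obtain ⟨R, hR, hR01, hRA⟩ := h
  -- Compare `R` with the root pulled back along `exp`: their ratio is a constant root of unity, so
  -- the pulled-back root closes up because `R` does.
  have hcirc := eq_of_pow_eq_const hn
    (q := fun t : I ↦ R t / exp (g (2 * Real.pi * (t : ℝ) * Complex.I, 0) / n)) (c := 1)
    (hR.div (by fun_prop) fun t ↦ exp_ne_zero _) one_ne_zero
    (fun t ↦ by rw [div_pow, hRA, hroot, div_self (h0 _ _ (exp_ne_zero _))]) 0 1
  have hR1 : R 1 ≠ 0 := fun h1 ↦ h0 _ 0 (exp_ne_zero _) ((hRA 1).symm.trans (by rw [h1, zero_pow hn]))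
  have hbase : exp (g (0 + 2 * Real.pi * Complex.I, 0) / n) = exp (g (0, 0) / n) := by
    simp only [hR01] at hcirc
    rw [div_eq_div_iff (exp_ne_zero _) (exp_ne_zero _)] at hcirc
    simpa using mul_left_cancel₀ hR1 hcirc
  -- Translation by the period changes the root by a constant root of unity, which `hbase` shows to
  -- be 1.
  have hper := eq_of_pow_eq_const (X := ℂ × ℝ) hn
    (q := fun q ↦ exp (g (q.1 + 2 * Real.pi * Complex.I, q.2) / n) / exp (g q / n)) (c := 1)
    (Continuous.div (by fun_prop) (by fun_prop) fun t ↦ exp_ne_zero _) one_ne_zero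
    (fun q ↦ by
      rw [div_pow, hroot, hroot q.1 q.2, exp_periodic, div_self (h0 _ _ (exp_ne_zero _))])
    (w, t) (0, 0)
  simp only [hbase, div_self (exp_ne_zero _)] at hper
  exact (div_eq_one_iff_eq (exp_ne_zero _)).1 hper

open Complex in
/-- If a function on `(ℂ ∖ 0) × ℝ` has a closed `n`-th root along the unit circle, then it has a
closed `n`-th root along every loop. -/
theorem HasClosedRoot.of_unit_circle {n : ℕ} (hn : n ≠ 0) {A : ℂ × ℝ → ℂ} (hA : Continuous A)
    (h0 : ∀ z t, z ≠ 0 → A (z, t) ≠ 0)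
    (h : HasClosedRoot n fun t ↦ A (exp (2 * Real.pi * (t : ℝ) * Complex.I), 0))
    {γ : I → ℂ × ℝ} (hγ : Continuous γ) (hγ0 : ∀ t, (γ t).1 ≠ 0) (hγ01 : γ 0 = γ 1) :
    HasClosedRoot n fun t ↦ A (γ t) := by
  obtain ⟨S, hS, hSA, hper⟩ := exists_periodic_root hn hA h0 h
  -- The path is extended by constants to the simply connected line `ℝ`.
  obtain ⟨l', hl', hlγ'⟩ := exists_continuous_log
    (f := fun t : ℝ ↦ (γ (Set.projIcc 0 1 zero_le_one t)).1)
    (continuous_fst.comp (hγ.comp continuous_projIcc)) (fun t ↦ hγ0 _)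
  obtain ⟨l, hl, hlγ⟩ : ∃ l : I → ℂ, Continuous l ∧ ∀ t, exp (l t) = (γ t).1 :=
    ⟨fun t ↦ l' t, by fun_prop, fun t ↦ by rw [hlγ', Set.projIcc_val]⟩
  have hperN : ∀ (k : ℕ) w t, S (w + k * (2 * Real.pi * Complex.I), t) = S (w, t) := by
    intro k
    induction k with
    | zero => simp
    | succ k ih =>
      intro w t
      rw [← ih w t, Nat.cast_succ, add_one_mul, ← add_assoc, hper]
  refine ⟨fun t ↦ S (l t, (γ t).2), by fun_prop, ?_, fun t ↦ by rw [hSA, hlγ]⟩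
  obtain ⟨m, hm⟩ := exp_eq_exp_iff_exists_int.1 ((hlγ 0).trans ((congrArg _ hγ01).trans (hlγ 1).symm))
  dsimp only
  rw [hγ01]
  obtain ⟨k, rfl | rfl⟩ := m.eq_nat_or_neg
  · rw [hm]
    exact_mod_cast hperN k _ _
  · rw [← hperN k (l 0), hm]
    push_cast
    ring_nf

open Complex in
/-- A small loop around a codimension two locus along which `f` behaves like
`(α + iβ)^a (β + iα)^b` has no closed `n`-th root, unless `n` divides `a - b`. -/
theorem exists_loop_not_hasClosedRoot {E : Type*} [NormedAddCommGroup E] [NormedSpace ℝ E]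
    {n a b : ℕ} (hn : n ≠ 0) (hab : ¬ (n : ℤ) ∣ (a : ℤ) - b) {f u : E → ℂ} {α β : E →L[ℝ] ℝ}
    {p v w : E} (hαp : α p = 0) (hβp : β p = 0) (hαv : α v = 1) (hβv : β v = 0) (hαw : α w = 0)
    (hβw : β w = 1) (hu : Continuous u) (hup : u p ≠ 0)
    (hf : ∀ᶠ x in nhds p, f x = (α x + β x * Complex.I) ^ a * (β x + α x * Complex.I) ^ b * u x)
    {V : Set E} (hV : V ∈ nhds p) :
    ∃ s : I → E, Continuous s ∧ s 0 = s 1 ∧ (∀ t, s t ∈ V) ∧ (∀ t, f (s t) ≠ 0) ∧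
      ¬ HasClosedRoot n fun t ↦ f (s t) := by
  have hn' : (n : ℂ) ≠ 0 := by exact_mod_cast hn
  -- Near `p` the unit factor has a continuous principal root, so it contributes nothing to the
  -- winding.
  have hslit : ∀ᶠ x in nhds p, u x / u p ∈ slitPlane := by
    refine (hu.div_const (u p)).continuousAt.eventually (isOpen_slitPlane.mem_nhds ?_)
    simpa only [div_self hup] using one_mem_slitPlane
  obtain ⟨W, hW, hWf⟩ : ∃ W ∈ nhds p, ∀ x ∈ W,
      f x = (α x + β x * Complex.I) ^ a * (β x + α x * Complex.I) ^ b * u x ∧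
        u x / u p ∈ slitPlane ∧ x ∈ V :=
    ⟨_, hf.and (hslit.and hV), fun x hx ↦ hx⟩
  have hK : IsCompact (Set.range fun t : I ↦
      Real.cos (2 * Real.pi * t) • v + Real.sin (2 * Real.pi * t) • w) :=
    isCompact_range (by fun_prop)
  have htube : ∀ᶠ ε : ℝ in nhds 0, ∀ y ∈ Set.range fun t : I ↦
      Real.cos (2 * Real.pi * t) • v + Real.sin (2 * Real.pi * t) • w, p + ε • y ∈
      W := by
    refine hK.eventually_forall_of_forall_eventually fun y _ ↦ ?_
    exact (show Continuous fun x : ℝ × E ↦ p + x.1 • x.2 by fun_prop).continuousAt.eventually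
      (by simpa using hW)
  obtain ⟨ε, hε, hε0⟩ : ∃ ε : ℝ, (∀ y ∈ Set.range fun t : I ↦
      Real.cos (2 * Real.pi * t) • v + Real.sin (2 * Real.pi * t) • w, p + ε • y ∈
      W) ∧
      0 < ε :=
    ((htube.filter_mono nhdsWithin_le_nhds).and
      (self_mem_nhdsWithin : Set.Ioi (0 : ℝ) ∈ nhdsWithin 0 (Set.Ioi 0))).exists
  have hεc : (ε : ℂ) ≠ 0 := by exact_mod_cast hε0.ne'
  set s : I → E := fun t ↦
    p + ε • (Real.cos (2 * Real.pi * t) • v + Real.sin (2 * Real.pi * t) • w) with hs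
  have hsc : Continuous s := by fun_prop
  have hs01 : s 0 = s 1 := by simp [hs]
  have hα : ∀ t, (α (s t) : ℂ) + β (s t) * Complex.I = ε * exp (2 * Real.pi * (t : ℝ) * Complex.I) := by
    intro t
    rw [exp_mul_I]
    simp [hs, hαp, hβp, hαv, hβv, hαw, hβw]
    ring
  -- This is `i` times the conjugate of the expression in `hα`, hence the opposite winding.
  have hβ : ∀ t, (β (s t) : ℂ) + α (s t) * Complex.I = ε * Complex.I * exp (-(2 * Real.pi * (t : ℝ) * Complex.I)) := by
    intro t
    rw [← neg_mul, exp_mul_I]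
    simp [hs, hαp, hβp, hαv, hβv, hαw, hβw]
    linear_combination (ε * sin (2 * Real.pi * (t : ℝ)) : ℂ) * I_sq
  have hfs : ∀ t, f (s t) = ε ^ (a + b) * Complex.I ^ b * u p * (u (s t) / u p) *
      exp (((a : ℂ) - b) * (2 * Real.pi * (t : ℝ) * Complex.I)) := by
    intro t
    rw [(hWf _ (hε _ ⟨t, rfl⟩)).1, hα, hβ, sub_mul, exp_sub, exp_nat_mul, exp_nat_mul, exp_neg, mul_pow,
      mul_pow, mul_pow, inv_pow, pow_add]
    change _ * u (s t) = _
    generalize u (s t) = y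
    field_simp
  have hus : ∀ t, u (s t) / u p ≠ 0 := fun t ↦ slitPlane_ne_zero (hWf _ (hε _ ⟨t, rfl⟩)).2.1
  have hf0 : ∀ t, f (s t) ≠ 0 := by
    intro t
    rw [hfs]
    exact mul_ne_zero (mul_ne_zero (mul_ne_zero (mul_ne_zero (pow_ne_zero _ hεc)
      (pow_ne_zero _ I_ne_zero)) hup) (hus t)) (exp_ne_zero _)
  refine ⟨s, hsc, hs01, fun t ↦ (hWf _ (hε _ ⟨t, rfl⟩)).2.2, hf0, ?_⟩
  rintro ⟨R, hR, hR01, hRf⟩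
  have hroot0 : ∀ t, (u (s t) / u p) ^ ((n : ℂ)⁻¹) ≠ 0 := fun t h ↦
    hus t (by rw [← cpow_nat_inv_pow (u (s t) / u p) hn, h, zero_pow hn])
  -- The explicit root in the denominator is multiplied by `exp (2πi(a - b)/n)` along the loop; a
  -- closed `R` forces this factor to be 1.
  have key := eq_of_pow_eq_const hn (q := fun t : I ↦ R t / ((u (s t) / u p) ^ ((n : ℂ)⁻¹) *
      exp (((a : ℂ) - b) * (2 * Real.pi * (t : ℝ) * Complex.I) / n))) (c := ε ^ (a + b) * Complex.I ^ b * u p)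
    (hR.div (Continuous.mul (Continuous.cpow (by fun_prop) continuous_const fun t ↦ (hWf _ (hε _ ⟨t, rfl⟩)).2.1)
      (by fun_prop)) fun t ↦ mul_ne_zero (hroot0 t) (exp_ne_zero _))
    (mul_ne_zero (mul_ne_zero (pow_ne_zero _ hεc) (pow_ne_zero _ I_ne_zero)) hup)
    (fun t ↦ by
      have hut := hus t
      rw [div_pow, mul_pow, cpow_nat_inv_pow _ hn, ← exp_nat_mul, mul_div_cancel₀ _ hn', (hRf t).trans (hfs t)]
      generalize u (s t) / u p = y at hut
      field_simp) 0 1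
  have hR1 : R 1 ≠ 0 := fun h1 ↦ hf0 1 ((hRf 1).symm.trans (by rw [h1, zero_pow hn]))
  simp only [hR01, hs01] at key
  rw [div_eq_div_iff (mul_ne_zero (hroot0 1) (exp_ne_zero _))
    (mul_ne_zero (hroot0 1) (exp_ne_zero _))] at key
  have key := mul_left_cancel₀ (hroot0 1) (mul_left_cancel₀ hR1 key)
  obtain ⟨m, hm⟩ := exp_eq_exp_iff_exists_int.1 key
  apply hab
  refine ⟨m, ?_⟩
  have h2 : (2 * Real.pi * Complex.I : ℂ) ≠ 0 := two_pi_I_ne_zero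
  have : ((a : ℂ) - b) = n * m := by
    have hm' : ((a : ℂ) - b) * (2 * Real.pi * Complex.I) = n * m * (2 * Real.pi * Complex.I) := by
      simp at hm
      field_simp at hm ⊢
      linear_combination hm
    exact mul_right_cancel₀ h2 hm'
  exact_mod_cast this

/-! ### The cyclic covering by roots -/

/-- The space of `n`-th roots of a continuous function on `X`. -/
def RootSpace {X : Type*} [TopologicalSpace X] (F : C(X, ℂ)) (n : ℕ) : Type _ :=
  {q : X × ℂ // q.2 ^ n = F q.1}

namespace RootSpace

variable {X : Type*} [TopologicalSpace X] {F : C(X, ℂ)} {n : ℕ}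

instance : TopologicalSpace (RootSpace F n) := inferInstanceAs (TopologicalSpace (Subtype _))

/-- The projection of the space of roots to the base. -/
def proj (F : C(X, ℂ)) (n : ℕ) (q : RootSpace F n) : X := q.1.1

/-- The value of the root. -/
def root (q : RootSpace F n) : ℂ := q.1.2

theorem root_pow (q : RootSpace F n) : q.root ^ n = F (proj F n q) := q.2

theorem continuous_proj : Continuous (proj F n) := continuous_fst.comp continuous_subtype_val

theorem continuous_root : Continuous (root : RootSpace F n → ℂ) :=
  continuous_snd.comp continuous_subtype_val

theorem ext {q q' : RootSpace F n} (h₁ : proj F n q = proj F n q') (h₂ : q.root = q'.root) :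
    q = q' :=
  Subtype.ext (Prod.ext h₁ h₂)

instance [T2Space X] : T2Space (RootSpace F n) := inferInstanceAs (T2Space (Subtype _))

instance [LocallyCompactSpace X] : LocallyCompactSpace (RootSpace F n) :=
  (isClosed_eq (by fun_prop) (by fun_prop) :
    IsClosed {q : X × ℂ | q.2 ^ n = F q.1}).isClosedEmbedding_subtypeVal.locallyCompactSpace

variable [NeZero n]

theorem stdAddChar_pow (g : ZMod n) : ZMod.stdAddChar g ^ n = (1 : ℂ) := by
  rw [← AddChar.map_nsmul_eq_pow]
  simp

instance : MulAction (Multiplicative (ZMod n)) (RootSpace F n) where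
  smul g q := ⟨(q.1.1, ZMod.stdAddChar g.toAdd * q.1.2), by
    simpa [mul_pow, stdAddChar_pow] using q.2⟩
  one_smul q := Subtype.ext (Prod.ext rfl (by
    change ZMod.stdAddChar (0 : ZMod n) * q.1.2 = _
    simp))
  mul_smul g g' q := Subtype.ext (Prod.ext rfl (by
    change ZMod.stdAddChar (g.toAdd + g'.toAdd) * q.1.2 = _ * (_ * q.1.2)
    rw [AddChar.map_add_eq_mul, mul_assoc]))

theorem root_smul (g : Multiplicative (ZMod n)) (q : RootSpace F n) :
    (g • q).root = ZMod.stdAddChar g.toAdd * q.root := rfl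

instance : ContinuousConstSMul (Multiplicative (ZMod n)) (RootSpace F n) where
  continuous_const_smul _ := Continuous.subtype_mk (continuous_proj.prodMk
    (continuous_const.mul continuous_root)) _

theorem exists_stdAddChar_eq {z : ℂ} (hz : z ^ n = 1) : ∃ g : ZMod n, ZMod.stdAddChar g = z := by
  obtain ⟨i, -, rfl⟩ := (Complex.isPrimitiveRoot_exp n (NeZero.ne n)).eq_pow_of_pow_eq_one hz
  refine ⟨((i : ℤ) : ZMod n), ?_⟩
  rw [ZMod.stdAddChar_coe, ← Complex.exp_nat_mul]
  congr 1
  push_cast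
  ring

theorem root_ne_zero (h0 : ∀ x, F x ≠ 0) (q : RootSpace F n) : q.root ≠ 0 := fun h ↦
  h0 _ (by rw [← root_pow, h, zero_pow (NeZero.ne n)])

theorem proj_eq_iff (h0 : ∀ x, F x ≠ 0) {q q' : RootSpace F n} :
    proj F n q = proj F n q' ↔ q ∈ MulAction.orbit (Multiplicative (ZMod n)) q' := by
  constructor
  · intro h
    obtain ⟨g, hg⟩ := exists_stdAddChar_eq (n := n) (z := q.root / q'.root) (by
      rw [div_pow, root_pow, root_pow, h, div_self (h0 _)])
    refine ⟨Multiplicative.ofAdd g, ext h.symm ?_⟩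
    change (Multiplicative.ofAdd g • q').root = _
    rw [root_smul, toAdd_ofAdd, hg, div_mul_cancel₀ _ (root_ne_zero h0 _)]
  · rintro ⟨g, rfl⟩
    rfl

theorem isCancelSMul (h0 : ∀ x, F x ≠ 0) :
    IsCancelSMul (Multiplicative (ZMod n)) (RootSpace F n) where
  right_cancel' g g' q h := by
    have := congrArg root h
    rw [root_smul, root_smul] at this
    exact ZMod.injective_stdAddChar (mul_right_cancel₀ (root_ne_zero h0 q) this)

/-- Through each `q` passes a section, the principal root of `F x / F (proj F n q)` times `q.root`.
It need only be continuous at the base point of `q`, where the ratio is 1. -/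
theorem isQuotientMap_proj (h0 : ∀ x, F x ≠ 0) : Topology.IsQuotientMap (proj F n) := by
  refine IsOpenMap.isQuotientMap (IsOpenMap.of_sections fun q ↦ ?_) continuous_proj fun x ↦
    ⟨⟨(x, F x ^ ((n : ℂ)⁻¹)), Complex.cpow_nat_inv_pow _ (NeZero.ne n)⟩, rfl⟩
  refine ⟨fun x ↦ ⟨(x, q.root * (F x / F (proj F n q)) ^ ((n : ℂ)⁻¹)), ?_⟩, ?_, ?_, fun x ↦ rfl⟩
  · rw [mul_pow, Complex.cpow_nat_inv_pow _ (NeZero.ne n), root_pow, mul_div_cancel₀ _ (h0 _)]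
  · refine Topology.IsInducing.subtypeVal.continuousAt_iff.2 (continuousAt_id.prodMk
      (continuousAt_const.mul (ContinuousAt.cpow (by fun_prop) continuousAt_const ?_)))
    rw [div_self (h0 _)]
    exact Complex.one_mem_slitPlane
  · refine ext rfl ?_
    change q.root * _ = _
    rw [div_self (h0 _), Complex.one_cpow, mul_one]

/-- A free action of a finite group on a locally compact Hausdorff space is properly discontinuous,
so the quotient map is a covering. -/
theorem isQuotientCoveringMap_proj [T2Space X] [LocallyCompactSpace X] (h0 : ∀ x, F x ≠ 0) :
    IsQuotientCoveringMap (proj F n) (Multiplicative (ZMod n)) :=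
  have := isCancelSMul (F := F) (n := n) h0
  (isQuotientMap_proj h0).isQuotientCoveringMap_of_properlyDiscontinuousSMul (proj_eq_iff h0)

end RootSpace

/-! ### Monodromy and deck group -/

/-- The monodromy of a covering with abelian deck group, as a homomorphism to the deck group. -/
theorem IsQuotientCoveringMap.exists_monodromy_hom {E X G : Type*} [TopologicalSpace E]
    [TopologicalSpace X] [CommGroup G] [MulAction G E] {p : E → X}
    (hp : IsQuotientCoveringMap p G) (x : X) :
    ∃ φ : FundamentalGroup X x →* G, ∀ (γ : FundamentalGroup X x) (e : p ⁻¹' {x}),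
      (hp.isCoveringMap.monodromy γ.toPath e : E) = φ γ • (e : E) := by
  obtain ⟨e₀, he₀⟩ := hp.surjective x
  let e₀' : p ⁻¹' {x} := ⟨e₀, he₀⟩
  refine ⟨MulOpposite.opMulEquiv.symm.toMonoidHom.comp (hp.fundamentalGroupToMulOpposite e₀'),
    fun γ e ↦ ?_⟩
  -- Monodromy commutes with deck transformations, so commutativity makes the element found at `e₀`
  -- work at every point of the fibre.
  obtain ⟨g, rfl⟩ := hp.exists_toPermFiber_eq e₀' e
  have h : (hp.fundamentalGroupToMulOpposite e₀' γ).unop • e₀ =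
      (hp.isCoveringMap.monodromy γ.toPath e₀' : E) :=
    hp.unop_fundamentalGroupToMulOpposite_smul
  rw [hp.monodromy_toPermFiber]
  change g • (hp.isCoveringMap.monodromy γ.toPath e₀' : E) =
    (hp.fundamentalGroupToMulOpposite e₀' γ).unop • g • e₀
  rw [← h, smul_smul, smul_smul, mul_comm]

/-- A lift of a loop that closes up is a closed root of the function along the loop. -/
theorem RootSpace.hasClosedRoot_of_monodromy_eq {X : Type*} [TopologicalSpace X] {F : C(X, ℂ)}
    {n : ℕ} (hp : IsCoveringMap (RootSpace.proj F n)) {x : X} (m : Path x x)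
    {e : RootSpace.proj F n ⁻¹' {x}} (h : hp.monodromy (Path.Homotopic.Quotient.mk m) e = e) :
    HasClosedRoot n fun t ↦ F (m t) := by
  have hx : m 0 = RootSpace.proj F n e := m.source.trans e.2.symm
  refine ⟨fun t ↦ (hp.liftPath m e hx t).root, continuous_root.comp (ContinuousMap.continuous _),
    ?_, fun t ↦ ?_⟩
  · have h1 : hp.liftPath m e hx 1 = e := congrArg Subtype.val h
    simp only [h1, hp.liftPath_zero]
  · rw [root_pow]
    exact congrArg F (congrFun (hp.liftPath_lifts m e hx) t)

/-- If the monodromy of a loop generates a cyclic deck group of prime order, then the preimage of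
the loop is connected. -/
theorem IsQuotientCoveringMap.isConnected_preimage_range {E X : Type*} [TopologicalSpace E]
    [TopologicalSpace X] {l : ℕ} [Fact l.Prime] [MulAction (Multiplicative (ZMod l)) E]
    {p : E → X} (hp : IsQuotientCoveringMap p (Multiplicative (ZMod l))) {x : X} (m : Path x x)
    (h : ∀ e, hp.isCoveringMap.monodromy (Path.Homotopic.Quotient.mk m) e ≠ e) :
    IsConnected (p ⁻¹' Set.range m) := by
  obtain ⟨e, he⟩ := hp.surjective x
  have hx : m 0 = p e := m.source.trans he.symm
  set ω := hp.isCoveringMap.liftPath m e hx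
  have hω0 : ω 0 = e := hp.isCoveringMap.liftPath_zero _ _ _
  have hlift : ∀ t, p (ω t) = m t := congrFun (hp.isCoveringMap.liftPath_lifts m e hx)
  have hne : ω 1 ≠ e := fun h1 ↦ h ⟨e, he⟩ (Subtype.ext h1)
  obtain ⟨g, hg⟩ := hp.apply_eq_iff_mem_orbit.1
    ((hlift 1).trans (m.target.trans he.symm) : p (ω 1) = p e)
  change g • e = ω 1 at hg
  have hg1 : g ≠ 1 := by
    rintro rfl
    exact hne (by rw [← hg, one_smul])
  have := hp.toContinuousConstSMul
  have hconn : ∀ k : ℕ, IsConnected (Set.range fun t ↦ g ^ k • ω t) := fun k ↦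
    isConnected_range (ω.continuous.const_smul _)
  -- As `l` is prime, the powers of `g ≠ 1` exhaust the group, so these translates of one lift fill
  -- the preimage. Each ends where the next begins.
  have hunion : p ⁻¹' Set.range m = ⋃ k : ℕ, Set.range fun t ↦ g ^ k • ω t := by
    ext y
    simp only [Set.mem_preimage, Set.mem_range, Set.mem_iUnion]
    constructor
    · rintro ⟨t, ht⟩
      obtain ⟨g', hg'⟩ := hp.apply_eq_iff_mem_orbit.1 (ht.symm.trans (hlift t).symm)
      have hcard : Nat.card (Multiplicative (ZMod l)) = l := by simp
      obtain ⟨k, hk⟩ := mem_powers_of_prime_card (p := l) hcard hg1 (g' := g')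
      exact ⟨k, t, by rw [← hg', ← hk]⟩
    · rintro ⟨k, t, rfl⟩
      exact ⟨t, by rw [hp.map_smul, hlift]⟩
  rw [hunion]
  refine IsConnected.iUnion_of_chain hconn fun k ↦ ⟨g ^ k • ω 1, ⟨1, rfl⟩, 0, ?_⟩
  simp only [hω0, ← hg, Order.succ_eq_add_one, pow_succ, mul_smul]

/-! ### The function of the prism and its zeros -/

/-- A function of four real variables that vanishes, on the cone over a lateral face of the prism,
exactly at the cone over the boundary of that face. -/
def lateralFun (y a b s : ℝ) : ℂ := y + (min (min a b) (min s (a + b - s)) : ℝ) * Complex.I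

theorem lateralFun_eq_zero {y a b s : ℝ} :
    lateralFun y a b s = 0 ↔ y = 0 ∧ min (min a b) (min s (a + b - s)) = 0 := by
  simp [lateralFun, Complex.ext_iff]

theorem lateralFun_mul {r : ℝ} (hr : 0 ≤ r) (y a b s : ℝ) :
    lateralFun (r * y) (r * a) (r * b) (r * s) = r * lateralFun y a b s := by
  simp only [lateralFun, ← mul_add, ← mul_sub, ← mul_min_of_nonneg _ _ hr]
  push_cast
  ring

/-- The form near a vertical side of the face, where `a` vanishes and is the smallest of the four
terms. -/
theorem lateralFun_of_le {y a b s : ℝ} (h1 : a ≤ b) (h2 : a ≤ s) (h3 : s ≤ b) :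
    lateralFun y a b s = y + a * Complex.I := by
  rw [lateralFun, min_eq_left h1, min_eq_left (le_min h2 (by linarith))]

theorem lateralFun_comm (y a b s : ℝ) : lateralFun y a b s = lateralFun y b a s := by
  rw [lateralFun, lateralFun, min_comm a b, add_comm a b]

/-- The function of the `i`-th lateral face, on `ℝ⁴`. -/
def prismFace (i : Fin 3) (x : EuclideanSpace ℝ (Fin 4)) : ℂ :=
  lateralFun (x i.castSucc) (x (i + 1).castSucc) (x (i + 2).castSucc) (x 3)

theorem continuous_prismFace (i : Fin 3) : Continuous (prismFace i) := by
  unfold prismFace lateralFun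
  fun_prop

/-- A function on `ℝ⁴` whose zero set is the cone over the skeleton of the prism. -/
def prismFun (x : EuclideanSpace ℝ (Fin 4)) : ℂ := ∏ i : Fin 3, prismFace i x ^ (2 ^ (i : ℕ))

theorem continuous_prismFun : Continuous prismFun := by
  unfold prismFun
  have := continuous_prismFace
  fun_prop

theorem prismFun_smul {r : ℝ} (hr : 0 ≤ r) (x : EuclideanSpace ℝ (Fin 4)) :
    prismFun (r • x) = r ^ 7 * prismFun x := by
  have h : ∀ i, prismFace i (r • x) = r * prismFace i x := fun i ↦ lateralFun_mul hr _ _ _ _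
  simp only [prismFun, h, Fin.prod_univ_three]
  simp
  ring

/-- Indices are cyclic, so that one argument in `i` treats all three faces. -/
theorem prismFun_eq (i : Fin 3) (x : EuclideanSpace ℝ (Fin 4)) :
    prismFun x = prismFace i x ^ (2 ^ (i : ℕ)) * prismFace (i + 1) x ^ (2 ^ ((i + 1 : Fin 3) : ℕ)) *
      prismFace (i + 2) x ^ (2 ^ ((i + 2 : Fin 3) : ℕ)) := by
  rw [prismFun, Fin.prod_univ_three]
  fin_cases i
  · rfl
  · change _ = prismFace 1 x ^ 2 * prismFace 2 x ^ 4 * prismFace 0 x ^ 1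
    simp
    ring
  · change _ = prismFace 2 x ^ 4 * prismFace 0 x ^ 1 * prismFace 1 x ^ 2
    simp
    ring

theorem prismFace_succ (i : Fin 3) (x : EuclideanSpace ℝ (Fin 4)) :
    prismFace (i + 1) x =
      lateralFun (x (i + 1).castSucc) (x (i + 2).castSucc) (x i.castSucc) (x 3) := by
  fin_cases i <;> rfl

theorem prismFace_add_two (i : Fin 3) (x : EuclideanSpace ℝ (Fin 4)) :
    prismFace (i + 2) x =
      lateralFun (x (i + 2).castSucc) (x i.castSucc) (x (i + 1).castSucc) (x 3) := by
  fin_cases i <;> rfl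

theorem prismGraph_adj_iff {a b : Fin 3 × Fin 2} : prismGraph.Adj a b ↔
    (a.1 = b.1 ∧ a.2 ≠ b.2) ∨ (a.1 ≠ b.1 ∧ a.2 = b.2) := by
  simp [prismGraph, SimpleGraph.boxProd_adj]
  tauto

theorem prismVertex_castSucc (a : Fin 3 × Fin 2) (i : Fin 3) :
    prismVertex a i.castSucc = if i = a.1 then 1 else 0 := by
  have : i.castSucc ≠ (3 : Fin 4) := (Fin.castSucc_lt_last i).ne
  simp [prismVertex, this]

theorem prismVertex_three (a : Fin 3 × Fin 2) : prismVertex a 3 = ((a.2 : ℕ) : ℝ) := by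
  have : (3 : Fin 4) ≠ a.1.castSucc := (Fin.castSucc_lt_last _).ne'
  simp [prismVertex, this]

theorem prism_ext {x y : EuclideanSpace ℝ (Fin 4)} (i : Fin 3) (h0 : x i.castSucc = y i.castSucc)
    (h1 : x (i + 1).castSucc = y (i + 1).castSucc) (h2 : x (i + 2).castSucc = y (i + 2).castSucc)
    (h3 : x 3 = y 3) : x = y := by
  ext k
  fin_cases i <;> fin_cases k <;> assumption

/-- The relations between the coordinates of a point in an open edge: a vertical edge opposite to
the `i`-th lateral face, or an edge in the bottom or the top of that face. -/
theorem exists_coord_of_mem_openSegment {a b : Fin 3 × Fin 2} (hab : prismGraph.Adj a b)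
    {x : EuclideanSpace ℝ (Fin 4)} (hx : x ∈ openSegment ℝ (prismVertex a) (prismVertex b)) :
    ∃ i : Fin 3, (x (i + 1).castSucc = 0 ∧ x (i + 2).castSucc = 0 ∧ 0 < x 3 ∧
        x 3 < x i.castSucc) ∨
      (x i.castSucc = 0 ∧ 0 < x (i + 1).castSucc ∧ 0 < x (i + 2).castSucc ∧
        (x 3 = 0 ∨ x 3 = x (i + 1).castSucc + x (i + 2).castSucc)) := by
  obtain ⟨s, t, hs, ht, hst, rfl⟩ := hx
  obtain ⟨a₁, a₂⟩ := a
  obtain ⟨b₁, b₂⟩ := b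
  simp only [PiLp.add_apply, PiLp.smul_apply, smul_eq_mul, prismVertex_castSucc,
    prismVertex_three]
  obtain ⟨h1, h2⟩ | ⟨h1, h2⟩ := prismGraph_adj_iff.1 hab
  · simp only at h1 h2
    subst h1
    refine ⟨a₁, .inl ?_⟩
    fin_cases a₂ <;> fin_cases b₂ <;> simp_all <;> linarith
  · simp only at h1 h2
    subst h2
    have hi : ∃ i : Fin 3, (a₁ = i + 1 ∧ b₁ = i + 2) ∨ (a₁ = i + 2 ∧ b₁ = i + 1) := by
      clear hab
      revert a₁ b₁
      decide
    have hne : ∀ i : Fin 3, i ≠ i + 1 ∧ i ≠ i + 2 ∧ i + 1 ≠ i + 2 := by decide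
    obtain ⟨i, hi⟩ := hi
    obtain ⟨n1, n2, n3⟩ := hne i
    refine ⟨i, .inr ?_⟩
    obtain ⟨rfl, rfl⟩ | ⟨rfl, rfl⟩ := hi <;> fin_cases a₂ <;>
      simp [n1, n2, n3, n3.symm, hs, ht, add_comm]

/-- The coordinate relations treat the open edge; its end points follow because the zero set is
closed. -/
theorem prismFun_eq_zero_of_mem_segment {a b : Fin 3 × Fin 2} (hab : prismGraph.Adj a b)
    {x : EuclideanSpace ℝ (Fin 4)} (hx : x ∈ segment ℝ (prismVertex a) (prismVertex b)) :
    prismFun x = 0 := by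
  have hclosed : IsClosed {x | prismFun x = 0} := isClosed_eq continuous_prismFun continuous_const
  refine closure_minimal (fun y hy ↦ ?_) hclosed (segment_subset_closure_openSegment hx)
  obtain ⟨i, ⟨h1, h2, h3, h4⟩ | ⟨h0, h1, h2, h3⟩⟩ := exists_coord_of_mem_openSegment hab hy
  · have : prismFace (i + 1) y = 0 := by
      rw [prismFace_succ, lateralFun_of_le (by linarith) (by linarith) h4.le, h1, h2]
      simp
    simp [prismFun_eq i, this]
  · have : prismFace i y = 0 := by
      rw [prismFace, lateralFun_eq_zero]
      refine ⟨h0, ?_⟩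
      obtain h3 | h3 := h3 <;> rw [h3]
      · rw [min_eq_left (a := (0 : ℝ)) (by linarith), min_eq_right (by simp; constructor <;> linarith)]
      · rw [sub_self, min_eq_right (a := _ + _) (by linarith),
          min_eq_right (by simp; constructor <;> linarith)]
    simp [prismFun_eq i, this]

/-- At a zero of the `i`-th face function the four terms of the minimum are nonnegative. Scaling by
the inverse of the coordinate sum reaches the hyperplane of the prism, and the term that vanishes
names the side of the face. -/
theorem exists_smul_mem_segment {x : EuclideanSpace ℝ (Fin 4)} (hx : x ≠ 0)
    (h : prismFun x = 0) : ∃ r : ℝ, 0 < r ∧ ∃ a b, prismGraph.Adj a b ∧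
      r • x ∈ segment ℝ (prismVertex a) (prismVertex b) := by
  obtain ⟨i, -, hi⟩ := Finset.prod_eq_zero_iff.1 h
  have hi := eq_zero_of_pow_eq_zero hi
  rw [prismFace, lateralFun_eq_zero] at hi
  obtain ⟨h0, hmin⟩ := hi
  have hle := hmin.ge
  simp only [le_min_iff] at hle
  obtain ⟨⟨h1, h2⟩, h3, h4⟩ := hle
  have hne : ∀ i : Fin 3, i ≠ i + 1 ∧ i ≠ i + 2 ∧ i + 1 ≠ i + 2 := by decide
  obtain ⟨n1, n2, n3⟩ := hne i
  have hpos : 0 < x (i + 1).castSucc + x (i + 2).castSucc := by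
    -- If the sum vanishes, so do both summands and the height between 0 and the sum, against `x ≠
    -- 0`.
    refine lt_of_le_of_ne (by linarith) fun hs ↦ hx (prism_ext i h0 ?_ ?_ ?_)
    all_goals simp only [PiLp.zero_apply]; linarith
  have hS := hpos.ne'
  refine ⟨(x (i + 1).castSucc + x (i + 2).castSucc)⁻¹, inv_pos.2 hpos, ?_⟩
  have hcases : x (i + 1).castSucc = 0 ∨ x (i + 2).castSucc = 0 ∨ x 3 = 0 ∨
      x 3 = x (i + 1).castSucc + x (i + 2).castSucc := by
    rcases min_choice (min (x (i + 1).castSucc) (x (i + 2).castSucc))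
      (min (x 3) (x (i + 1).castSucc + x (i + 2).castSucc - x 3)) with h | h <;>
    rw [h] at hmin
    · rcases min_choice (x (i + 1).castSucc) (x (i + 2).castSucc) with h | h <;>
        rw [h] at hmin <;> simp [hmin]
    · rcases min_choice (x 3) (x (i + 1).castSucc + x (i + 2).castSucc - x 3) with h | h <;>
        rw [h] at hmin
      · simp [hmin]
      · exact .inr (.inr (.inr (by linarith)))
  set S := x (i + 1).castSucc + x (i + 2).castSucc
  obtain h | h | h | h := hcases
  · refine ⟨(i + 2, 0), (i + 2, 1), prismGraph_adj_iff.2 (by simp), 1 - S⁻¹ * x 3, S⁻¹ * x 3, ?_,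
      by positivity, by ring, prism_ext i ?_ ?_ ?_ ?_⟩
    · rw [sub_nonneg, inv_mul_le_one₀ hpos]
      linarith
    all_goals simp [prismVertex_castSucc, prismVertex_three, n2, n3, h0, h]
    rw [eq_comm, inv_mul_eq_one₀ hS]
    linarith
  · refine ⟨(i + 1, 0), (i + 1, 1), prismGraph_adj_iff.2 (by simp), 1 - S⁻¹ * x 3, S⁻¹ * x 3, ?_,
      by positivity, by ring, prism_ext i ?_ ?_ ?_ ?_⟩
    · rw [sub_nonneg, inv_mul_le_one₀ hpos]
      linarith
    all_goals simp [prismVertex_castSucc, prismVertex_three, n1, n3.symm, h0, h]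
    rw [eq_comm, inv_mul_eq_one₀ hS]
    linarith
  · refine ⟨(i + 1, 0), (i + 2, 0), prismGraph_adj_iff.2 (by simp), S⁻¹ * x (i + 1).castSucc,
      S⁻¹ * x (i + 2).castSucc, by positivity, by positivity, ?_, prism_ext i ?_ ?_ ?_ ?_⟩
    · rw [← mul_add, inv_mul_cancel₀ hS]
    all_goals simp [prismVertex_castSucc, prismVertex_three, n1, n2, n3, n3.symm, h0, h]
  · refine ⟨(i + 1, 1), (i + 2, 1), prismGraph_adj_iff.2 (by simp), S⁻¹ * x (i + 1).castSucc,
      S⁻¹ * x (i + 2).castSucc, by positivity, by positivity, ?_, prism_ext i ?_ ?_ ?_ ?_⟩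
    · rw [← mul_add, inv_mul_cancel₀ hS]
    all_goals simp [prismVertex_castSucc, prismVertex_three, n1, n2, n3, n3.symm, h0, h]
    rw [← mul_add]

theorem prismFun_eq_zero_iff (x : S3) :
    prismFun x = 0 ↔ x ∈ stdPrismSkeleton := by
  constructor
  · intro h
    obtain ⟨r, hr, a, b, hab, hx⟩ := exists_smul_mem_segment
      (norm_ne_zero_iff.1 (by simp : ‖(x : EuclideanSpace ℝ (Fin 4))‖ ≠ 0)) h
    exact ⟨a, b, hab, r, hr, hx⟩
  · rintro ⟨a, b, hab, r, hr, hx⟩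
    have := prismFun_eq_zero_of_mem_segment hab hx
    rw [prismFun_smul hr.le] at this
    exact (mul_eq_zero.1 this).resolve_left (pow_ne_zero _ (by exact_mod_cast hr.ne'))

/-! ### Small loops around the edges -/

/-- With `α`, `β` the two coordinates that vanish on the edge, the adjacent faces have the functions
`α + iβ` and `β + iα` near `p`, and the third is nonzero there. -/
theorem exists_loop_vertical {i : Fin 3} {p : EuclideanSpace ℝ (Fin 4)}
    (h1 : p (i + 1).castSucc = 0) (h2 : p (i + 2).castSucc = 0) (h3 : 0 < p 3)
    (h4 : p 3 < p i.castSucc) {V : Set (EuclideanSpace ℝ (Fin 4))} (hV : V ∈ nhds p) :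
    ∃ s : I → EuclideanSpace ℝ (Fin 4), Continuous s ∧ s 0 = s 1 ∧ (∀ t, s t ∈ V) ∧
      (∀ t, prismFun (s t) ≠ 0) ∧ ¬ HasClosedRoot 7 fun t ↦ prismFun (s t) := by
  have hne : ∀ i : Fin 3, i + 1 ≠ i + 2 ∧
      ¬ ((7 : ℕ) : ℤ) ∣ ((2 ^ ((i + 1 : Fin 3) : ℕ) : ℕ) : ℤ) - (2 ^ ((i + 2 : Fin 3) : ℕ) : ℕ) := by
    decide
  obtain ⟨n3, hdvd⟩ := hne i
  refine exists_loop_not_hasClosedRoot (by norm_num) hdvd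
    (α := EuclideanSpace.proj (i + 1).castSucc) (β := EuclideanSpace.proj (i + 2).castSucc)
    (u := fun x ↦ prismFace i x ^ (2 ^ (i : ℕ)))
    (v := EuclideanSpace.single (i + 1).castSucc 1) (w := EuclideanSpace.single (i + 2).castSucc 1)
    h1 h2 (by simp) (by simp [n3.symm]) (by simp [n3]) (by simp)
    ((continuous_prismFace i).pow _) (pow_ne_zero _ fun h ↦ ?_) ?_ hV
  · rw [prismFace, lateralFun_eq_zero] at h
    linarith [h.1]
  · have hev : ∀ᶠ x in nhds p, x 3 < x i.castSucc ∧ x (i + 1).castSucc < x 3 ∧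
        x (i + 2).castSucc < x 3 := by
      simp only [Filter.eventually_and]
      exact ⟨ContinuousAt.eventually_lt (by fun_prop) (by fun_prop) h4,
        ContinuousAt.eventually_lt (by fun_prop) (by fun_prop) (h1.trans_lt h3),
        ContinuousAt.eventually_lt (by fun_prop) (by fun_prop) (h2.trans_lt h3)⟩
    filter_upwards [hev] with x ⟨hx1, hx2, hx3⟩
    rw [prismFun_eq i, prismFace_succ, prismFace_add_two, lateralFun_comm _ (x i.castSucc),
      lateralFun_of_le (by linarith) hx3.le hx1.le, lateralFun_of_le (by linarith) hx2.le hx1.le]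
    simp only [PiLp.proj_apply]
    ring

/-- Only the `i`-th face function vanishes at `p`; `β` is the term of its minimum that is active
near the edge. -/
theorem exists_loop_horizontal {i : Fin 3} {p w : EuclideanSpace ℝ (Fin 4)}
    {β : EuclideanSpace ℝ (Fin 4) →L[ℝ] ℝ}
    (h0 : p i.castSucc = 0) (h1 : 0 < p (i + 1).castSucc) (h2 : 0 < p (i + 2).castSucc)
    (hβp : β p = 0) (hβ : β (EuclideanSpace.single i.castSucc 1) = 0) (hw : w i.castSucc = 0)
    (hβw : β w = 1) (hf : ∀ᶠ x in nhds p, prismFace i x = x i.castSucc + β x * Complex.I)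
    {V : Set (EuclideanSpace ℝ (Fin 4))} (hV : V ∈ nhds p) :
    ∃ s : I → EuclideanSpace ℝ (Fin 4), Continuous s ∧ s 0 = s 1 ∧ (∀ t, s t ∈ V) ∧
      (∀ t, prismFun (s t) ≠ 0) ∧ ¬ HasClosedRoot 7 fun t ↦ prismFun (s t) := by
  have hdvd : ∀ i : Fin 3, ¬ ((7 : ℕ) : ℤ) ∣ ((2 ^ (i : ℕ) : ℕ) : ℤ) - (0 : ℕ) := by decide
  refine exists_loop_not_hasClosedRoot (by norm_num) (hdvd i)
    (α := EuclideanSpace.proj i.castSucc) (β := β)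
    (u := fun x ↦ prismFace (i + 1) x ^ (2 ^ ((i + 1 : Fin 3) : ℕ)) *
      prismFace (i + 2) x ^ (2 ^ ((i + 2 : Fin 3) : ℕ)))
    (v := EuclideanSpace.single i.castSucc 1) (w := w) h0 hβp (by simp) hβ hw hβw
    (((continuous_prismFace _).pow _).mul ((continuous_prismFace _).pow _))
    (mul_ne_zero (pow_ne_zero _ fun h ↦ ?_) (pow_ne_zero _ fun h ↦ ?_)) ?_ hV
  · rw [prismFace, lateralFun_eq_zero] at h
    exact h1.ne' h.1
  · rw [prismFace, lateralFun_eq_zero] at h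
    exact h2.ne' h.1
  · filter_upwards [hf] with x hx
    rw [prismFun_eq i, hx]
    simp only [PiLp.proj_apply]
    ring

/-- Around a point of an open edge of the prism there are small loops along which the function of
the prism has no seventh root. -/
theorem exists_loop_of_mem_openSegment {a b : Fin 3 × Fin 2} (hab : prismGraph.Adj a b)
    {p : EuclideanSpace ℝ (Fin 4)} (hp : p ∈ openSegment ℝ (prismVertex a) (prismVertex b))
    {V : Set (EuclideanSpace ℝ (Fin 4))} (hV : V ∈ nhds p) :
    ∃ s : I → EuclideanSpace ℝ (Fin 4), Continuous s ∧ s 0 = s 1 ∧ (∀ t, s t ∈ V) ∧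
      (∀ t, prismFun (s t) ≠ 0) ∧ ¬ HasClosedRoot 7 fun t ↦ prismFun (s t) := by
  obtain ⟨i, ⟨h1, h2, h3, h4⟩ | ⟨h0, h1, h2, h3⟩⟩ := exists_coord_of_mem_openSegment hab hp
  · exact exists_loop_vertical h1 h2 h3 h4 hV
  have hne : ∀ i : Fin 3, i ≠ i + 1 ∧ i ≠ i + 2 := by decide
  obtain ⟨n1, n2⟩ := hne i
  have hi3 : i.castSucc ≠ (3 : Fin 4) := (Fin.castSucc_lt_last i).ne
  have hj3 : ∀ j : Fin 3, j.castSucc ≠ (3 : Fin 4) := fun j ↦ (Fin.castSucc_lt_last j).ne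
  obtain h3 | h3 := h3
  · refine exists_loop_horizontal (β := EuclideanSpace.proj 3) (w := EuclideanSpace.single 3 1)
      h0 h1 h2 h3 (by simp [hi3.symm]) (by simp [hi3]) (by simp) ?_ hV
    have hev : ∀ᶠ x in nhds p, x 3 < x (i + 1).castSucc ∧ x 3 < x (i + 2).castSucc ∧
        x 3 < x (i + 1).castSucc + x (i + 2).castSucc - x 3 := by
      simp only [Filter.eventually_and]
      exact ⟨ContinuousAt.eventually_lt (by fun_prop) (by fun_prop) (h3.trans_lt h1),
        ContinuousAt.eventually_lt (by fun_prop) (by fun_prop) (h3.trans_lt h2),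
        ContinuousAt.eventually_lt (by fun_prop) (by fun_prop) (by linarith)⟩
    filter_upwards [hev] with x ⟨hx1, hx2, hx3⟩
    rw [prismFace, lateralFun, min_eq_left hx3.le, min_eq_right (le_min hx1.le hx2.le)]
    simp
  · refine exists_loop_horizontal (β := EuclideanSpace.proj (i + 1).castSucc +
      EuclideanSpace.proj (i + 2).castSucc - EuclideanSpace.proj 3)
      (w := EuclideanSpace.single 3 (-1)) h0 h1 h2 (by simp [h3]) (by simp [hi3.symm, n1.symm, n2.symm])
      (by simp [hi3]) (by simp [hj3]) ?_ hV
    have hev : ∀ᶠ x in nhds p, x (i + 1).castSucc + x (i + 2).castSucc - x 3 < x (i + 1).castSucc ∧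
        x (i + 1).castSucc + x (i + 2).castSucc - x 3 < x (i + 2).castSucc ∧
        x (i + 1).castSucc + x (i + 2).castSucc - x 3 < x 3 := by
      simp only [Filter.eventually_and]
      exact ⟨ContinuousAt.eventually_lt (by fun_prop) (by fun_prop) (by linarith),
        ContinuousAt.eventually_lt (by fun_prop) (by fun_prop) (by linarith),
        ContinuousAt.eventually_lt (by fun_prop) (by fun_prop) (by linarith)⟩
    filter_upwards [hev] with x ⟨hx1, hx2, hx3⟩
    rw [prismFace, lateralFun, min_eq_right hx3.le, min_eq_right (le_min hx1.le hx2.le)]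
    simp

/-- Radial projection of a loop in `ℝ⁴` changes the function by `‖s t‖ ^ 7`, which has the closed
root `‖s t‖`. -/
theorem exists_loop_of_mem_stdPrismEdge {a b : Fin 3 × Fin 2} (hab : prismGraph.Adj a b)
    {p : S3} (hp : p ∈ stdPrismEdge a b) {U : Set S3} (hU : U ∈ nhds p) :
    ∃ s : I → S3, Continuous s ∧ s 0 = s 1 ∧ (∀ t, s t ∈ U) ∧
      (∀ t, prismFun (s t) ≠ 0) ∧ ¬ HasClosedRoot 7 fun t ↦ prismFun (s t) := by
  obtain ⟨r, hr, hrp⟩ := hp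
  obtain ⟨U', hU', hUU'⟩ := mem_nhds_subtype _ _ _ |>.1 hU
  have hp1 : ‖(p : EuclideanSpace ℝ (Fin 4))‖ = 1 := by simp
  have hrp0 : r • (p : EuclideanSpace ℝ (Fin 4)) ≠ 0 :=
    smul_ne_zero hr.ne' (norm_ne_zero_iff.1 (by simp))
  have hnormalize : ContinuousAt (fun x : EuclideanSpace ℝ (Fin 4) ↦ ‖x‖⁻¹ • x)
      (r • (p : EuclideanSpace ℝ (Fin 4))) :=
    ContinuousAt.smul (ContinuousAt.inv₀ (by fun_prop) (norm_ne_zero_iff.2 hrp0)) continuousAt_id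
  have hV : ∀ᶠ x in nhds (r • (p : EuclideanSpace ℝ (Fin 4))), x ≠ 0 ∧ ‖x‖⁻¹ • x ∈ U' := by
    refine (eventually_ne_nhds hrp0).and (hnormalize ?_)
    have : ‖r • (p : EuclideanSpace ℝ (Fin 4))‖⁻¹ • r • (p : EuclideanSpace ℝ (Fin 4)) = p := by
      rw [norm_smul, hp1, mul_one, Real.norm_of_nonneg hr.le, inv_smul_smul₀ hr.ne']
    simpa only [this] using hU'
  obtain ⟨s, hs, hs01, hsV, hs0, hroot⟩ := exists_loop_of_mem_openSegment hab hrp hV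
  have hnorm : ∀ t, ‖s t‖ ≠ 0 := fun t ↦ norm_ne_zero_iff.2 (hsV t).1
  have hf : ∀ t, prismFun (s t) = (‖s t‖ : ℂ) ^ 7 * prismFun (‖s t‖⁻¹ • s t) := by
    intro t
    rw [← prismFun_smul (norm_nonneg _), smul_inv_smul₀ (hnorm t)]
  have hsc : Continuous fun t ↦ ‖s t‖⁻¹ • s t :=
    Continuous.smul (Continuous.inv₀ (by fun_prop) hnorm) hs
  have hsS : ∀ t, ‖s t‖⁻¹ • s t ∈ Metric.sphere (0 : EuclideanSpace ℝ (Fin 4)) 1 := fun t ↦ by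
    simp [norm_smul, hnorm t]
  refine ⟨fun t ↦ ⟨‖s t‖⁻¹ • s t, hsS t⟩,
    hsc.subtype_mk hsS,
    by simp only [hs01], fun t ↦ hUU' (hsV t).2, fun t h ↦ hs0 t ?_, ?_⟩
  · rw [hf, h, mul_zero]
  · rintro ⟨R, hR, hR01, hRf⟩
    exact hroot ⟨fun t ↦ ‖s t‖ * R t, by fun_prop, by simp only [hs01, hR01], fun t ↦ by
      rw [mul_pow, hRf]
      exact (hf t).symm⟩

/-! ### Meridians in arbitrary charts -/

/-- The function of the prism has no seventh root along the boundary of a meridian disc of an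
edge. -/
theorem not_hasClosedRoot_meridian {a b : Fin 3 × Fin 2} (hab : prismGraph.Adj a b)
    {k : ℂ × ℝ → S3} (hk : IsMeridianChart stdPrismSkeleton (stdPrismEdge a b) k) :
    ¬ HasClosedRoot 7 fun t ↦
      prismFun (k (Complex.exp (2 * Real.pi * (t : ℝ) * Complex.I), 0)) := by
  intro h
  have hopen := hk.isOpenEmbedding
  obtain ⟨s, hs, hs01, hsU, hs0, hroot⟩ := exists_loop_of_mem_stdPrismEdge hab (hk.axis_mem 0)
    (hopen.isOpen_range.mem_nhds ⟨_, rfl⟩)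
  choose γ hγ using hsU
  have hγc : Continuous γ := hopen.isInducing.continuous_iff.2 (by simpa [Function.comp_def, hγ])
  have hzero : ∀ z t, prismFun (k (z, t)) = 0 ↔ z = 0 := fun z t ↦
    (prismFun_eq_zero_iff _).trans (hk.mem_iff z t)
  refine hroot ?_
  have := h.of_unit_circle (A := fun q ↦ prismFun (k q)) (by norm_num)
    (continuous_prismFun.comp (continuous_subtype_val.comp hopen.continuous))
    (fun z t hz h ↦ hz ((hzero z t).1 h)) hγc
    (fun t h ↦ hs0 t (by rw [← hγ]; exact (hzero _ _).2 h))
    (hopen.injective (by rw [hγ, hγ, hs01]))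
  simpa only [hγ] using this

theorem IsMeridianChart.comp_homeomorph {Γ e : Set S3} {h : ℂ × ℝ → S3} (Φ : S3 ≃ₜ S3)
    (hh : IsMeridianChart (Φ '' Γ) (Φ '' e) h) : IsMeridianChart Γ e (Φ.symm ∘ h) where
  isOpenEmbedding := Φ.symm.isOpenEmbedding.comp hh.isOpenEmbedding
  mem_iff z t := by
    rw [← hh.mem_iff z t, Φ.image_eq_preimage_symm]
    rfl
  axis_mem t := by
    have := hh.axis_mem t
    rwa [Φ.image_eq_preimage_symm] at this

/-- Every coordinate cylinder has a meridian loop, and it runs through the meridional curve. -/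
theorem IsMeridianChart.exists_isMeridianLoop {Γ e : Set S3} {h : ℂ × ℝ → S3}
    (hh : IsMeridianChart Γ e h) :
    ∃ (x : ↥Γᶜ) (m : Path x x), IsMeridianLoop h m ∧ Set.range m = meridianCurve Γ h := by
  have hmem : ∀ t : I, h (Complex.exp (2 * Real.pi * (t : ℝ) * Complex.I), 0) ∈ Γᶜ := fun t ht ↦
    Complex.exp_ne_zero _ ((hh.mem_iff _ _).1 ht)
  have hc := hh.isOpenEmbedding.continuous
  let f : I → ↥Γᶜ := fun t ↦ ⟨_, hmem t⟩
  have hf : Continuous f := by fun_prop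
  let m : Path (f 0) (f 0) := ⟨⟨f, hf⟩, rfl, Subtype.ext (by simp [f])⟩
  refine ⟨f 0, m, fun t ↦ rfl, ?_⟩
  ext x
  constructor
  · rintro ⟨t, rfl⟩
    refine ⟨_, ?_, rfl⟩
    rw [Complex.norm_exp]
    simp
  · rintro ⟨z, hz, hx⟩
    obtain ⟨t, ht, hzt⟩ : ∃ t : ℝ, t ∈ I ∧
        Complex.exp (2 * Real.pi * (t : ℝ) * Complex.I) = z := by
      have h2 := Real.two_pi_pos
      -- The argument is moved from `(-π, π]` to `[0, 2π)` to give a parameter in the unit interval.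
      refine ⟨toIcoMod h2 0 z.arg / (2 * Real.pi), ⟨?_, ?_⟩, ?_⟩
      · exact div_nonneg (left_le_toIcoMod h2 0 _) h2.le
      · rw [div_le_one h2]
        simpa using (toIcoMod_lt_right h2 0 z.arg).le
      · have hcast : (2 * Real.pi * ((toIcoMod h2 0 z.arg / (2 * Real.pi) : ℝ) : ℂ) * Complex.I) =
            z.arg * Complex.I - toIcoDiv h2 0 z.arg * (2 * Real.pi * Complex.I) := by
          rw [toIcoMod]
          have : (Real.pi : ℂ) ≠ 0 := by exact_mod_cast Real.pi_ne_zero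
          push_cast
          simp
          field_simp
        rw [hcast, Complex.exp_periodic.sub_int_mul_eq]
        simpa [hz] using Complex.norm_mul_exp_arg_mul_I z
    exact ⟨⟨t, ht⟩, Subtype.ext (by rw [← hx, ← hzt]; rfl)⟩

end

/-! ### The covering of the complement -/

theorem mainTheorem11 (Γ : Set S3) (Φ : S3 ≃ₜ S3) (hΓ : Γ = Φ '' stdPrismSkeleton) :
    ∃ (E : Type) (_ : TopologicalSpace E) (_ : MulAction (Multiplicative (ZMod 7)) E)
      (p : E → ↥Γᶜ) (hp : IsCoveringMap p),
      -- the covering is seven-fold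
      (∀ x, (p ⁻¹' {x}).ncard = 7) ∧
      -- it is regular with deck group `ℤ/7`
      IsQuotientCoveringMap p (Multiplicative (ZMod 7)) ∧
      -- the preimage of every meridional curve of every edge has one component
      (∀ a b, prismGraph.Adj a b → ∀ h, IsMeridianChart Γ (Φ '' stdPrismEdge a b) h →
        IsConnected (p ⁻¹' meridianCurve Γ h)) ∧
      -- its monodromy is a homomorphism to `ℤ/7` that sends all meridians to nonzero elements
      (∀ x₀ : ↥Γᶜ, ∃ φ : FundamentalGroup ↥Γᶜ x₀ →* Multiplicative (ZMod 7),
        (∀ (γ : FundamentalGroup ↥Γᶜ x₀) (e : p ⁻¹' {x₀}),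
          (hp.monodromy γ.toPath e : E) = φ γ • (e : E)) ∧
        (∀ a b, prismGraph.Adj a b → ∀ h, IsMeridianChart Γ (Φ '' stdPrismEdge a b) h →
          ∀ (x₁ : ↥Γᶜ) (δ : Path x₀ x₁) (m : Path x₁ x₁), IsMeridianLoop h m →
            φ (FundamentalGroup.fromPath
              (Path.Homotopic.Quotient.mk (δ.trans (m.trans δ.symm)))) ≠ 1)) := by
  subst hΓ
  set Γ := Φ '' stdPrismSkeleton with hΓ
  have hmemΓ : ∀ x : S3, prismFun (Φ.symm x) = 0 ↔ x ∈ Γ := fun x ↦ by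
    rw [prismFun_eq_zero_iff, hΓ, Φ.image_eq_preimage_symm, Set.mem_preimage]
  have hcont : Continuous fun x : S3 ↦ prismFun (Φ.symm x) :=
    continuous_prismFun.comp (continuous_subtype_val.comp Φ.symm.continuous)
  have hclosed : IsClosed Γ := by
    convert isClosed_eq hcont continuous_const using 1
    ext x
    exact (hmemΓ x).symm
  have : LocallyCompactSpace ↥Γᶜ := hclosed.isOpen_compl.locallyCompactSpace
  let F : C(↥Γᶜ, ℂ) := ⟨fun x ↦ prismFun (Φ.symm x), hcont.comp continuous_subtype_val⟩
  have hF : ∀ x, F x ≠ 0 := fun x h ↦ x.2 ((hmemΓ x).1 h)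
  have hq : IsQuotientCoveringMap (RootSpace.proj F 7) (Multiplicative (ZMod 7)) :=
    RootSpace.isQuotientCoveringMap_proj hF
  have hmeridian : ∀ a b, prismGraph.Adj a b → ∀ h, IsMeridianChart Γ (Φ '' stdPrismEdge a b) h →
      ∀ (x : ↥Γᶜ) (m : Path x x), IsMeridianLoop h m →
        ∀ e, hq.isCoveringMap.monodromy (Path.Homotopic.Quotient.mk m) e ≠ e := by
    intro a b hab h hh x m hm e he
    refine not_hasClosedRoot_meridian hab (hh.comp_homeomorph Φ) ?_
    have := RootSpace.hasClosedRoot_of_monodromy_eq hq.isCoveringMap m he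
    have hFm : ∀ t, F (m t) = prismFun ((Φ.symm ∘ h)
        (Complex.exp (2 * Real.pi * (t : ℝ) * Complex.I), 0)) := fun t ↦ by
      change prismFun (Φ.symm (m t)) = _
      rw [hm t]
      rfl
    simpa only [hFm] using this
  refine ⟨RootSpace F 7, inferInstance, inferInstance, RootSpace.proj F 7, hq.isCoveringMap,
    fun x ↦ ?_, hq, fun a b hab h hh ↦ ?_, fun x₀ ↦ ?_⟩
  · obtain ⟨e, he⟩ := hq.surjective x
    rw [← Nat.card_coe_set_eq, Nat.card_congr (hq.fiberEquivGroup ⟨e, he⟩)]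
    simp
  · obtain ⟨x, m, hm, hrange⟩ := hh.exists_isMeridianLoop
    have : Fact (Nat.Prime 7) := ⟨by norm_num⟩
    rw [← hrange]
    exact hq.isConnected_preimage_range m (hmeridian a b hab h hh x m hm)
  · obtain ⟨φ, hφ⟩ := hq.exists_monodromy_hom x₀
    refine ⟨φ, hφ, fun a b hab h hh x₁ δ m hm h1 ↦ ?_⟩
    obtain ⟨e, he⟩ := hq.surjective x₀
    have hmon := hφ (FundamentalGroup.fromPath
      (Path.Homotopic.Quotient.mk (δ.trans (m.trans δ.symm)))) ⟨e, he⟩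
    rw [h1, one_smul] at hmon
    have hmon : hq.isCoveringMap.monodromy (Path.Homotopic.Quotient.mk (δ.trans (m.trans δ.symm)))
        ⟨e, he⟩ = ⟨e, he⟩ := Subtype.ext hmon
    simp only [Path.Homotopic.Quotient.mk_trans, IsCoveringMap.monodromy_trans_apply] at hmon
    refine hmeridian a b hab h hh x₁ m hm
      (hq.isCoveringMap.monodromy (Path.Homotopic.Quotient.mk δ) ⟨e, he⟩) ?_
    -- If the conjugated loop fixes `e`, then `m` fixes the transport of `e` along `δ`: apply the
    -- injective transport back along `δ.symm`.
    refine (hq.isCoveringMap.monodromy_bijective (Path.Homotopic.Quotient.mk δ.symm)).1 ?_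
    rw [hmon, ← IsCoveringMap.monodromy_trans_apply, ← Path.Homotopic.Quotient.mk_trans,
      Path.Homotopic.Quotient.eq.2 ⟨(Path.Homotopy.reflTransSymm δ).symm⟩]
    exact (congrFun hq.isCoveringMap.monodromy_refl _).symm
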